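/- Let $\mathbb K$ be a field, let $E$ be a finite set and let $\Delta$ be a simplicial complex on $E$ (a collection of subsets of $E$ that contains $\emptyset$ and is closed under taking subsets), of rank $r=\max_{S\in\Delta}|S|$. Let $\mathcal G$ be a surjective finite abelian group structure on $\Delta$: a finite abelian group $\mathcal G(S)$ for every $S\in\Delta$ together with surjective homomorphisms $\pi_{S,T}:\mathcal G(T)\to\mathcal G(S)$ for all $S\subseteq T$ in $\Delta$, such that $\pi_{S,S}=\mathrm{id}$ and $\pi_{S,T}\circ\pi_{T,U}=\pi_{S,U}$. Its independence poset $P=\mathrm{ind}(E,\Delta,\mathcal G)$ is the set $\{(S,g):S\in\Delta,\ g\in\mathcal G(S)\}$, where $(S\cup\{a\},g)$ covers $(S,h)$ (for $a\notin S$, $S\cup\{a\}\in\Delta$) if and only if $\pi_{S,S\cup\{a\}}(g)=h$. The associated torsion-free structure $\tilde{\mathcal G}$ is given by $\tilde{\mathcal G}(S)=\ker\big(\pi_{\emptyset,S}:\mathcal G(S)\to\mathcal G(\emptyset)\big)$ with the restricted maps, and $\tilde P=\mathrm{ind}(E,\Delta,\tilde{\mathcal G})$. For $y\in P$ let $\rho(y)$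 be the rank of the boolean algebra $\{x\in P: x\le y\}$, let $f_i$ be the number of $y\in P$ with $\rho(y)=i$, put $h_P(t)=\sum_{i=0}^r f_i\,(t-1)^{r-i}$, and define the $h$-vector $(h_0,\dots,h_r)$ of $P$ by $h_P(t)=\sum_{i=0}^r h_i t^{r-i}$. A finite poset $Q$ is simplicial if it has a least element $\hat 0$ and all intervals $[\hat 0,y]$ are boolean algebras; $\rho(y)$ then denotes the rank of $[\hat 0,y]$. Its Stanley–Reisner ring $\mathbb K[Q]$ is the quotient of the polynomial ring with one variable for each element of $Q$ by the ideal generated by: $yz$, for $y,z$ without a common upper bound; $yz-(y\wedge z)\sum_w w$, with $w$ ranging over the minimal upper bounds of $y$ and $z$, for all other pairs $y,z$; and $\hat 0-1$. Give it the grading induced by $\deg y=\rho(y)$, and let $\mathrm{Hilb}(\mathbb K[Q],t)=\sum_n \dim_{\mathbb K}(\mathbb K[Q]_n)\,t^n$. **Theorem.** (1) If $\mathcal G$ is torsion-free, i.e. $|\mathcal G(\emptyset)|=1$, then $P$ is a simplicial poset, $\mathbb K[P]$ is a graded algebra with finite-dimensional graded pieces, and $$\mathrm{Hilb}(\mathbb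 K[P],t)=\frac{h_0+h_1t+\dots+h_rt^r}{(1-t)^r}.$$ (2) In general (whether or not $\mathcal G$ is torsion-free), $\tilde P$ is a simplicial poset, $\mathbb K[\tilde P]$ is a graded algebra with finite-dimensional graded pieces, and $$\mathrm{Hilb}(\mathbb K[\tilde P],t)=\frac{1}{|\mathcal G(\emptyset)|}\cdot\frac{h_0+h_1t+\dots+h_rt^r}{(1-t)^r},$$ where $(h_0,\dots,h_r)$ is still the $h$-vector of $P$. -/

import Mathlib

open scoped Polynomial PowerSeries

noncomputable section

/-! ## Simplicial posets and their Stanley–Reisner rings -/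

section Posets

variable (P : Type*) [PartialOrder P]

/-- A simplicial poset: there is a least element, and every interval below an element `y`
(that is, from the least element to `y`) is a finite boolean algebra. -/
structure IsSimplicialPoset : Prop where
  exists_bot : ∃ b : P, IsBot b
  boolean : ∀ y : P, ∃ n : ℕ, Nonempty (Set.Iic y ≃o Finset (Fin n))

variable {P}

/-- `ρ(y)`: the rank of the boolean algebra of all elements below `y`. -/
def posetRho (y : P) : ℕ :=
  sInf {n : ℕ | Nonempty (Set.Iic y ≃o Finset (Fin n))}

variable (P)

/-- `f_i`: the number of elements `y` with `ρ(y) = i`. -/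
def fVector (i : ℕ) : ℕ := Nat.card {y : P // posetRho y = i}

/-- The rank of `P`: the largest value of `ρ`. -/
def posetRank : ℕ := sSup (Set.range (posetRho : P → ℕ))

/-- `f_P(t) = ∑ f_i t^(r-i)`. -/
def fPolynomial : ℤ[X] :=
  ∑ i ∈ Finset.range (posetRank P + 1), Polynomial.C (fVector P i : ℤ) * Polynomial.X ^ (posetRank P - i)

/-- `h_P(t) = f_P(t-1)`. -/
def hPolynomial : ℤ[X] := (fPolynomial P).comp (Polynomial.X - 1)

/-- The entries `h_i` (`0 ≤ i ≤ r`) of the `h`-vector, given by `h_P(t) = ∑ h_i t^(r-i)`. -/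
def hVector (i : ℕ) : ℤ := (hPolynomial P).coeff (posetRank P - i)

/-- `h_0 + h_1 t + ⋯ + h_r t^r`, as a formal power series with rational coefficients. -/
def hSeries : ℚ⟦X⟧ :=
  ∑ i ∈ Finset.range (posetRank P + 1), PowerSeries.C (hVector P i : ℚ) * PowerSeries.X ^ i

variable (K : Type*) [Field K] [Finite P]

/-- The generators of the Stanley–Reisner ideal of `P`, in the polynomial ring with one variable
for each element of `P`. -/
inductive IsStanleyReisnerRelation : MvPolynomial P K → Prop
  /-- `y z`, where `y`, `z` have no common upper bound. -/
  | noUpperBound (y z : P) (h : ¬ BddAbove {y, z}) :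
      IsStanleyReisnerRelation (MvPolynomial.X y * MvPolynomial.X z)
  /-- `y z - (y ∧ z) ∑ w`, with `w` ranging over the minimal upper bounds of `y`, `z`. -/
  | minimalUpperBounds (y z m : P) (h : BddAbove {y, z}) (hm : IsGLB {y, z} m) :
      IsStanleyReisnerRelation
        (MvPolynomial.X y * MvPolynomial.X z - MvPolynomial.X m *
          ∑ w ∈ (Set.toFinite {w : P | Minimal (· ∈ upperBounds {y, z}) w}).toFinset,
            MvPolynomial.X w)
  /-- `0̂ - 1`, where `0̂` is the least element. -/
  | bot (b : P) (hb : IsBot b) : IsStanleyReisnerRelation (MvPolynomial.X b - 1)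

/-- The Stanley–Reisner ideal of `P`. -/
def stanleyReisnerIdeal : Ideal (MvPolynomial P K) :=
  Ideal.span {p | IsStanleyReisnerRelation P K p}

/-- The Stanley–Reisner ring `K[P]`. -/
abbrev StanleyReisnerRing : Type _ := MvPolynomial P K ⧸ stanleyReisnerIdeal P K

/-- The degree-`n` part of `K[P]`: the image of the polynomials that are homogeneous of degree `n`
when the variable `y` has degree `ρ(y)`. -/
def stanleyReisnerGrading (n : ℕ) : Submodule K (StanleyReisnerRing P K) :=
  (MvPolynomial.weightedHomogeneousSubmodule K (posetRho : P → ℕ) n).map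
    (Ideal.Quotient.mkₐ K (stanleyReisnerIdeal P K)).toLinearMap

/-- The Hilbert series of `K[P]`, as a formal power series with rational coefficients. -/
def stanleyReisnerHilb : ℚ⟦X⟧ :=
  PowerSeries.mk fun n => (Module.finrank K (stanleyReisnerGrading P K n) : ℚ)

end Posets

/-! ## Surjective finite abelian group structures on a simplicial complex -/

/-- A (non-empty) simplicial complex on the ground set `E`. Unlike in `AbstractSimplicialComplex`,
the empty set is a face, and elements of `E` need not be vertices. -/
structure FaceComplex (E : Type*) where
  faces : Set (Finset E)
  empty_mem : ∅ ∈ faces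
  down_closed : ∀ ⦃S T : Finset E⦄, T ∈ faces → S ⊆ T → S ∈ faces

namespace FaceComplex

variable {E : Type*} (Δ : FaceComplex E)

/-- The faces of `Δ`, ordered by inclusion. -/
abbrev Face : Type _ := {S : Finset E // S ∈ Δ.faces}

/-- The empty face. -/
def emptyFace : Δ.Face := ⟨∅, Δ.empty_mem⟩

theorem emptyFace_le (S : Δ.Face) : Δ.emptyFace ≤ S := Finset.empty_subset S.1

/-- The rank of `Δ`: the largest cardinality of a face. -/
def rank : ℕ := sSup {i : ℕ | ∃ S ∈ Δ.faces, S.card = i}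

end FaceComplex

/-- A surjective finite abelian group structure on `Δ`: a (contravariant) functor from the poset of
faces to finite abelian groups all of whose maps are surjective. -/
structure SurjFinAbStructure {E : Type*} (Δ : FaceComplex E) where
  obj : Δ.Face → Type*
  [addCommGroup : ∀ S, AddCommGroup (obj S)]
  [finite : ∀ S, Finite (obj S)]
  map : ∀ {S T : Δ.Face}, S ≤ T → (obj T →+ obj S)
  map_id : ∀ (S : Δ.Face) (g : obj S), map (le_refl S) g = g
  map_comp : ∀ {S T U : Δ.Face} (h₁ : S ≤ T) (h₂ : T ≤ U) (g : obj U),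
    map h₁ (map h₂ g) = map (h₁.trans h₂) g
  map_surjective : ∀ {S T : Δ.Face} (h : S ≤ T), Function.Surjective (map h)

namespace SurjFinAbStructure

attribute [instance] SurjFinAbStructure.addCommGroup SurjFinAbStructure.finite

variable {E : Type*} {Δ : FaceComplex E} (G : SurjFinAbStructure Δ)

/-- `G` is torsion-free if `G(∅)` is trivial. -/
def IsTorsionFree : Prop := Nat.card (G.obj Δ.emptyFace) = 1

/-- The map `π_S : G(S) → G(∅)`. -/
def toEmpty (S : Δ.Face) : G.obj S →+ G.obj Δ.emptyFace := G.map (Δ.emptyFace_le S)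

/-- The associated torsion-free structure: `S ↦ ker π_S`, with the restricted maps. -/
def torsionFreePart : SurjFinAbStructure Δ where
  obj S := (G.toEmpty S).ker
  map {S T} h := ((G.map h).comp (G.toEmpty T).ker.subtype).codRestrict (G.toEmpty S).ker
    (fun g => by
      have hg : G.toEmpty T g.1 = 0 := g.2
      exact (G.map_comp (Δ.emptyFace_le S) h g.1).trans hg)
  map_id S g := Subtype.ext (G.map_id S g.1)
  map_comp h₁ h₂ g := Subtype.ext (G.map_comp h₁ h₂ g.1)
  map_surjective {S T} h := by
    rintro ⟨k, hk⟩
    obtain ⟨g, rfl⟩ := G.map_surjective h k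
    exact ⟨⟨g, (G.map_comp (Δ.emptyFace_le S) h g).symm.trans hk⟩, rfl⟩

/-- The ground set `{(S, g) : S ∈ Δ, g ∈ G(S)}` of the independence poset `ind(E, Δ, G)`. -/
def Ind : Type _ := Σ S : Δ.Face, G.obj S

/-- `(S, g) ≤ (T, h)` when `S ⊆ T` and `h` is mapped to `g`; see `Ind.covBy_iff` for the
corresponding cover relations. -/
instance : PartialOrder G.Ind where
  le x y := ∃ h : x.1 ≤ y.1, G.map h y.2 = x.2
  le_refl x := ⟨le_refl _, G.map_id _ _⟩
  le_trans x y z := by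
    rintro ⟨h₁, e₁⟩ ⟨h₂, e₂⟩
    exact ⟨h₁.trans h₂, by rw [← G.map_comp h₁ h₂, e₂, e₁]⟩
  le_antisymm x y := by
    rcases x with ⟨S, g⟩
    rcases y with ⟨T, k⟩
    rintro ⟨h₁, e₁⟩ ⟨h₂, e₂⟩
    obtain rfl : S = T := le_antisymm h₁ h₂
    have e : k = g := (G.map_id S k).symm.trans e₁
    rw [e]

instance [Finite E] : Finite G.Ind :=
  inferInstanceAs (Finite (Σ S : Δ.Face, G.obj S))

/-- The cover relations of `ind(E, Δ, G)`: `(S ∪ {a}, k)` covers `(S, g)` if and only if `k` is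
mapped to `g`. -/
theorem Ind.covBy_iff (x y : G.Ind) :
    x ⋖ y ↔ ∃ h : x.1 ≤ y.1, (∃ (a : E) (ha : a ∉ x.1.1), y.1.1 = Finset.cons a x.1.1 ha) ∧
      G.map h y.2 = x.2 := by
  have key : ∀ u v : G.Ind, u ≤ v → u.1.1 = v.1.1 → u = v := by
    intro u v huv h
    rcases u with ⟨S, g⟩
    rcases v with ⟨T, k⟩
    obtain rfl : S = T := Subtype.ext h
    obtain ⟨h₁, e₁⟩ := huv
    have e : k = g := (G.map_id S k).symm.trans e₁
    rw [e]
  constructor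
  · intro hxy
    obtain ⟨h, e⟩ := hxy.le
    refine ⟨h, ?_, e⟩
    have hne : x.1.1 ≠ y.1.1 := fun h' => hxy.ne (key x y hxy.le h')
    have hss : x.1.1 ⊂ y.1.1 := lt_of_le_of_ne h hne
    obtain ⟨a, hay, hax⟩ := Finset.exists_of_ssubset hss
    have hsub : Finset.cons a x.1.1 hax ⊆ y.1.1 := by
      intro b hb
      rcases Finset.mem_cons.1 hb with rfl | hb
      · exact hay
      · exact h hb
    let F : Δ.Face := ⟨Finset.cons a x.1.1 hax, Δ.down_closed y.1.2 hsub⟩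
    have hFy : F ≤ y.1 := hsub
    have hxF : x.1 ≤ F := Finset.subset_cons hax
    let z : G.Ind := ⟨F, G.map hFy y.2⟩
    have hzy : z ≤ y := ⟨hFy, rfl⟩
    have hxz : x ≤ z := ⟨hxF, (G.map_comp hxF hFy y.2).trans e⟩
    refine ⟨a, hax, ?_⟩
    rcases hxy.eq_or_eq hxz hzy with h' | h'
    · exfalso
      have h'' : Finset.cons a x.1.1 hax = x.1.1 := congrArg (fun w : G.Ind => w.1.1) h'
      exact hax (h'' ▸ Finset.mem_cons_self a _)
    · exact (congrArg (fun w : G.Ind => w.1.1) h').symm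
  · rintro ⟨h, ⟨a, ha, hy⟩, e⟩
    have hle : x ≤ y := ⟨h, e⟩
    refine ⟨lt_of_le_of_ne hle ?_, ?_⟩
    · rintro rfl
      exact ha (hy ▸ Finset.mem_cons_self a _)
    · intro z hxz hzy
      have h1 : x.1.1 ⊂ z.1.1 :=
        lt_of_le_of_ne hxz.le.1 fun h' => hxz.ne (key x z hxz.le h')
      have h2 : z.1.1 ⊂ y.1.1 :=
        lt_of_le_of_ne hzy.le.1 fun h' => hzy.ne (key z y hzy.le h')
      have c1 := Finset.card_lt_card h1
      have c2 := Finset.card_lt_card h2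
      rw [hy, Finset.card_cons] at c2
      omega

end SurjFinAbStructure

end

open scoped Polynomial PowerSeries

noncomputable section

/-! In the torsion-free case the ring has a basis of monomials `y ∏ y_a ^ n_a`, where `y_a` is the
atom below `y` over `a` and the exponent vector `n` is supported on the face of `y`. They span
because the defining relations are straightening rules: `z y` becomes `(z ∧ y) ∑ w`, and in each
term `w` absorbs the meet as a product of atoms below `w` (`srVar_mul_restrict`,
`srVar_mul_srMonomial_mem`). They are independent because each `u` gives a homomorphism `evalBelow
u` to the polynomial ring on `E` that kills every variable not below `u`; reading off one
coefficient of its value gives a dual family (`linearIndependent_srMonomial`).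

Counting basis elements gives `Hilb = ∑_y (t/(1-t)) ^ ρ(y)`. Reversing `h_P` gives `∑ h_i t^i = ∑_y
t^ρ(y) (1-t)^(r-ρ(y))`, which is the same sum times `(1-t)^r` (`hSeries_mul_inv`). In general
`|G(S)| = |G(∅)| · |ker π_S|` for every face, so passing to the torsion-free part divides the
h-vector by `|G(∅)|` (`hSeries_ind`). -/

namespace SurjFinAbStructure

variable {E : Type*} {Δ : FaceComplex E} {G : SurjFinAbStructure Δ}

/-! ### Order structure of independence posets -/

/-- The underlying face of an element of the independence poset. -/
def Ind.shape (x : G.Ind) : Finset E := x.1.1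

theorem Ind.shape_mono {x y : G.Ind} (h : x ≤ y) : x.shape ⊆ y.shape := h.1

/-- Both group components are images of that of `u`, so functoriality links them. Below a common
upper bound, order questions thus reduce to inclusions of faces. -/
theorem Ind.le_of_shape_subset {x y u : G.Ind} (hx : x ≤ u) (hy : y ≤ u)
    (h : x.shape ⊆ y.shape) : x ≤ y := by
  obtain ⟨hx, ex⟩ := hx
  obtain ⟨hy, ey⟩ := hy
  refine ⟨h, ?_⟩
  rw [← ex, ← ey]
  exact G.map_comp _ _ _

theorem Ind.eq_of_shape_eq {x y u : G.Ind} (hx : x ≤ u) (hy : y ≤ u)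
    (h : x.shape = y.shape) : x = y :=
  le_antisymm (le_of_shape_subset hx hy h.le) (le_of_shape_subset hy hx h.ge)

theorem Ind.eq_of_le_of_shape_eq {x y : G.Ind} (hx : x ≤ y) (h : x.shape = y.shape) : x = y :=
  eq_of_shape_eq hx le_rfl h

/-- The unique element below `u` whose underlying face is `shape u ∩ A`. -/
def Ind.restrict [DecidableEq E] (u : G.Ind) (A : Finset E) : G.Ind :=
  ⟨⟨u.shape ∩ A, Δ.down_closed u.1.2 Finset.inter_subset_left⟩,
    G.map (T := u.1) (show u.shape ∩ A ⊆ u.shape from Finset.inter_subset_left) u.2⟩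

theorem Ind.restrict_le [DecidableEq E] (u : G.Ind) (A : Finset E) : u.restrict A ≤ u :=
  ⟨Finset.inter_subset_left, rfl⟩

theorem Ind.shape_restrict [DecidableEq E] (u : G.Ind) (A : Finset E) :
    (u.restrict A).shape = u.shape ∩ A := rfl

theorem Ind.shape_restrict_of_subset [DecidableEq E] {u : G.Ind} {A : Finset E} (h : A ⊆ u.shape) :
    (u.restrict A).shape = A := Finset.inter_eq_right.2 h

theorem Ind.restrict_eq [DecidableEq E] {u x : G.Ind} {A : Finset E} (hx : x ≤ u)
    (h : u.shape ∩ A = x.shape) :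
    u.restrict A = x :=
  eq_of_shape_eq (u.restrict_le A) hx h

theorem Ind.restrict_eq_restrict [DecidableEq E] {u y : G.Ind} {A : Finset E} (hy : y ≤ u)
    (h : A ⊆ y.shape) :
    u.restrict A = y.restrict A :=
  restrict_eq ((y.restrict_le A).trans hy)
    (by rw [shape_restrict_of_subset h, Finset.inter_eq_right.2 (h.trans (shape_mono hy))])

/-- The interval below `y` is the boolean algebra of subsets of its underlying face. -/
def Ind.iicOrderIso [DecidableEq E] (y : G.Ind) : Set.Iic y ≃o Finset {a // a ∈ y.shape} where
  toFun x := x.1.shape.subtype (· ∈ y.shape)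
  invFun A := ⟨y.restrict (A.map (Function.Embedding.subtype _)), y.restrict_le _⟩
  left_inv x := by
    refine Subtype.ext (restrict_eq x.2 ?_)
    ext a
    have := @shape_mono _ _ _ _ _ x.2 a
    simp only [Finset.mem_inter, Finset.mem_map, Finset.mem_subtype,
      Function.Embedding.subtype_apply, Subtype.exists, exists_and_left, exists_prop,
      exists_eq_right_right]
    tauto
  right_inv A := by
    ext a
    simp [shape_restrict]
  map_rel_iff' {x z} := by
    refine ⟨fun h => le_of_shape_subset x.2 z.2 fun a ha => ?_, fun h a ha => ?_⟩
    · have := @h ⟨a, shape_mono x.2 ha⟩ (Finset.mem_subtype.2 ha)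
      exact Finset.mem_subtype.1 this
    · rw [Equiv.coe_fn_mk, Finset.mem_subtype] at ha ⊢
      exact shape_mono h ha

/-- The exponent is determined by the cardinality `2 ^ n`. Hence the set in `posetRho` is a
singleton and its infimum is never the default value. -/
theorem Ind.nonempty_iic_orderIso_iff (y : G.Ind) (n : ℕ) :
    Nonempty (Set.Iic y ≃o Finset (Fin n)) ↔ n = y.shape.card := by
  classical
  constructor
  · rintro ⟨e⟩
    have h := Fintype.card_congr (e.symm.trans y.iicOrderIso).toEquiv
    simp only [Fintype.card_finset, Fintype.card_fin, Fintype.card_coe] at h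
    exact Nat.pow_right_injective le_rfl h
  · rintro rfl
    exact ⟨y.iicOrderIso.trans
      { toEquiv := y.shape.equivFin.finsetCongr, map_rel_iff' := by simp }⟩

theorem posetRho_eq_card_shape (y : G.Ind) : posetRho y = y.shape.card := by
  simp only [posetRho, Ind.nonempty_iic_orderIso_iff, Set.ofPred_eq_eq_singleton, csInf_singleton]

theorem Ind.isGLB_iff [DecidableEq E] {y z u : G.Ind} (hy : y ≤ u) (hz : z ≤ u) (m : G.Ind) :
    IsGLB {y, z} m ↔ m ≤ u ∧ m.shape = y.shape ∩ z.shape := by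
  have key : IsGLB {y, z} (u.restrict (y.shape ∩ z.shape)) := by
    have hs : (u.restrict (y.shape ∩ z.shape)).shape = y.shape ∩ z.shape :=
      shape_restrict_of_subset (Finset.inter_subset_left.trans (shape_mono hy))
    constructor
    · rintro x (rfl | rfl)
      · exact le_of_shape_subset (u.restrict_le _) hy (hs.trans_subset Finset.inter_subset_left)
      · exact le_of_shape_subset (u.restrict_le _) hz (hs.trans_subset Finset.inter_subset_right)
    · intro x hx
      have h1 : x ≤ y := hx (by simp)
      have h2 : x ≤ z := hx (by simp)
      exact le_of_shape_subset (h1.trans hy) (u.restrict_le _)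
        (hs.symm ▸ Finset.subset_inter (shape_mono h1) (shape_mono h2))
  have hs : (u.restrict (y.shape ∩ z.shape)).shape = y.shape ∩ z.shape :=
    shape_restrict_of_subset (Finset.inter_subset_left.trans (shape_mono hy))
  constructor
  · intro h
    rw [h.unique key]
    exact ⟨u.restrict_le _, hs⟩
  · rintro ⟨h1, h2⟩
    rwa [eq_of_shape_eq h1 (u.restrict_le _) (h2.trans hs.symm)]

/-- Any upper bound restricts to one on the union of the two faces, and no upper bound has a smaller
face. -/
theorem Ind.minimal_upperBounds_iff [DecidableEq E] {y z w : G.Ind} :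
    Minimal (· ∈ upperBounds {y, z}) w ↔
      y ≤ w ∧ z ≤ w ∧ w.shape = y.shape ∪ z.shape := by
  simp only [upperBounds_insert, upperBounds_singleton, Set.mem_inter_iff, Set.mem_Ici]
  constructor
  · rintro ⟨⟨hy, hz⟩, h⟩
    have hsub : y.shape ∪ z.shape ⊆ w.shape := Finset.union_subset (shape_mono hy) (shape_mono hz)
    have hs := shape_restrict_of_subset hsub
    refine ⟨hy, hz, subset_antisymm ?_ hsub⟩
    rw [← hs]
    refine shape_mono (h ⟨?_, ?_⟩ (w.restrict_le _))
    · exact le_of_shape_subset hy (w.restrict_le _) (hs.symm ▸ Finset.subset_union_left)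
    · exact le_of_shape_subset hz (w.restrict_le _) (hs.symm ▸ Finset.subset_union_right)
  · rintro ⟨hy, hz, hs⟩
    refine ⟨⟨hy, hz⟩, fun v hv hvw => le_of_shape_subset le_rfl hvw ?_⟩
    rw [hs]
    exact Finset.union_subset (shape_mono hv.1) (shape_mono hv.2)

theorem IsTorsionFree.isBot_of_shape_eq_empty (hG : G.IsTorsionFree) {b : G.Ind}
    (hb : b.shape = ∅) : IsBot b := by
  intro x
  have hsub : Subsingleton (G.obj Δ.emptyFace) := (Nat.card_eq_one_iff_unique.1 hG).1
  rcases b with ⟨⟨S, hS⟩, g⟩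
  obtain rfl : S = ∅ := hb
  exact ⟨Finset.empty_subset _, hsub.elim _ _⟩

theorem Ind.shape_eq_empty_of_isBot {b : G.Ind} (hb : IsBot b) : b.shape = ∅ := by
  have h := shape_mono (hb ⟨Δ.emptyFace, 0⟩)
  exact Finset.subset_empty.1 h

theorem IsTorsionFree.isSimplicialPoset (hG : G.IsTorsionFree) : IsSimplicialPoset G.Ind where
  exists_bot := ⟨⟨Δ.emptyFace, 0⟩, hG.isBot_of_shape_eq_empty rfl⟩
  boolean y := ⟨_, (Ind.nonempty_iic_orderIso_iff y _).2 rfl⟩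

theorem isTorsionFree_torsionFreePart : G.torsionFreePart.IsTorsionFree := by
  refine Nat.card_eq_one_iff_unique.2 ⟨⟨?_⟩, ⟨0⟩⟩
  rintro ⟨x, hx⟩ ⟨y, hy⟩
  have h : ∀ z : G.obj Δ.emptyFace, G.toEmpty _ z = z := G.map_id _
  refine Subtype.ext ?_
  rw [AddMonoidHom.mem_ker, h] at hx hy
  exact hx.trans hy.symm

theorem posetRank_eq_rank [Finite E] : posetRank G.Ind = Δ.rank := by
  rw [posetRank, FaceComplex.rank]
  congr 1
  ext i
  constructor
  · rintro ⟨x, rfl⟩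
    exact ⟨x.1.1, x.1.2, (posetRho_eq_card_shape x).symm⟩
  · rintro ⟨S, hS, rfl⟩
    exact ⟨⟨⟨S, hS⟩, 0⟩, posetRho_eq_card_shape _⟩

/-! ### Relations between the variables in the Stanley–Reisner ring -/

section Relations

variable (K : Type*) [Field K] [Finite E]

/-- The class of the variable `y` in the Stanley–Reisner ring. -/
def srVar (y : G.Ind) : StanleyReisnerRing G.Ind K :=
  Ideal.Quotient.mk _ (MvPolynomial.X y)

variable {K}

theorem srVar_mul_eq_zero {y z : G.Ind} (h : ∀ u, y ≤ u → ¬ z ≤ u) :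
    srVar K y * srVar K z = 0 := by
  rw [srVar, srVar, ← map_mul, Ideal.Quotient.eq_zero_iff_mem]
  refine Ideal.subset_span (.noUpperBound y z ?_)
  rintro ⟨u, hu⟩
  exact h u (hu (by simp)) (hu (by simp))

theorem srVar_mul [DecidableEq E] {y z u m : G.Ind} (hy : y ≤ u) (hz : z ≤ u) (hm : m ≤ u)
    (h : m.shape = y.shape ∩ z.shape) :
    srVar K y * srVar K z = srVar K m *
      ∑ w ∈ (Set.toFinite {w : G.Ind | y ≤ w ∧ z ≤ w ∧ w.shape = y.shape ∪ z.shape}).toFinset,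
        srVar K w := by
  have hb : BddAbove {y, z} := ⟨u, by rintro x (rfl | rfl) <;> assumption⟩
  have hmem := Ideal.subset_span (IsStanleyReisnerRelation.minimalUpperBounds (K := K) y z m hb
    ((Ind.isGLB_iff hy hz m).2 ⟨hm, h⟩))
  have h0 := Ideal.Quotient.eq_zero_iff_mem.2 hmem
  rw [map_sub, map_mul, map_mul, map_sum, sub_eq_zero] at h0
  simp only [Ind.minimal_upperBounds_iff] at h0
  exact h0

theorem IsTorsionFree.srVar_eq_one (hG : G.IsTorsionFree) {b : G.Ind} (hb : b.shape = ∅) :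
    srVar K b = 1 := by
  have hmem := Ideal.subset_span (IsStanleyReisnerRelation.bot (K := K) b
    (hG.isBot_of_shape_eq_empty hb))
  have h0 := Ideal.Quotient.eq_zero_iff_mem.2 hmem
  rwa [map_sub, map_one, sub_eq_zero] at h0

/-- Multiplying atoms produces every minimal upper bound over `A`, but the factor `y` kills all of
them except the one below `y`: two elements over the same face with a common upper bound coincide.
-/
theorem IsTorsionFree.srVar_mul_restrict [DecidableEq E] (hG : G.IsTorsionFree) (y : G.Ind)
    {A : Finset E} (hA : A ⊆ y.shape) :
    srVar K y * srVar K (y.restrict A) = srVar K y * ∏ a ∈ A, srVar K (y.restrict {a}) := by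
  induction A using Finset.induction_on with
  | empty =>
    rw [hG.srVar_eq_one (b := y.restrict ∅) (Finset.inter_empty _), Finset.prod_empty]
  | insert a A ha ih =>
    have hA' : A ⊆ y.shape := (Finset.subset_insert a A).trans hA
    have ha' : {a} ⊆ y.shape := Finset.singleton_subset_iff.2 (hA (Finset.mem_insert_self a A))
    have hsa := Ind.shape_restrict_of_subset ha'
    have hsA := Ind.shape_restrict_of_subset hA'
    have hs := Ind.shape_restrict_of_subset hA
    have hun : ({a} : Finset E) ∪ A = insert a A := rfl
    -- As `a ∉ A`, the meet of the two restrictions is `y.restrict ∅`, which equals `1` in the ring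
    -- by torsion-freeness.
    rw [Finset.prod_insert ha, mul_left_comm, ← ih hA', mul_left_comm,
      srVar_mul (y.restrict_le {a}) (y.restrict_le A) (y.restrict_le ∅)
        (by rw [hsa, hsA, Finset.singleton_inter_of_notMem ha, Ind.shape_restrict,
          Finset.inter_empty]),
      hG.srVar_eq_one (b := y.restrict ∅) (Finset.inter_empty _), one_mul, Finset.mul_sum, hsa, hsA,
      hun]
    refine (Finset.sum_eq_single (f := fun w => srVar K y * srVar K w)
      (y.restrict (insert a A)) ?_ ?_).symm
    · intro w hw hne
      rw [Set.Finite.mem_toFinset] at hw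
      refine srVar_mul_eq_zero fun u hyu hwu => hne ?_
      exact Ind.eq_of_shape_eq hwu ((y.restrict_le _).trans hyu) (hw.2.2.trans hs.symm)
    · intro h
      refine absurd ?_ h
      rw [Set.Finite.mem_toFinset]
      refine ⟨Ind.le_of_shape_subset (y.restrict_le _) (y.restrict_le _) ?_,
        Ind.le_of_shape_subset (y.restrict_le _) (y.restrict_le _) ?_, hs⟩
      · rw [hsa, hs, ← hun]
        exact Finset.subset_union_left
      · rw [hsA, hs]
        exact Finset.subset_insert a A

end Relations

/-! ### The monomial basis -/

section Basis

/-- The exponent vector of the squarefree monomial with support `A`. -/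
def indicatorExp (A : Finset E) : E →₀ ℕ := ∑ a ∈ A, Finsupp.single a 1

theorem indicatorExp_apply_of_mem {A : Finset E} {a : E} (ha : a ∈ A) : indicatorExp A a = 1 := by
  classical
  simp [indicatorExp, Finsupp.finsetSum_apply, Finsupp.single_apply, ha]

theorem indicatorExp_apply_of_notMem {A : Finset E} {a : E} (ha : a ∉ A) :
    indicatorExp A a = 0 := by
  classical
  simp [indicatorExp, Finsupp.finsetSum_apply, Finsupp.single_apply, ha]

theorem support_indicatorExp (A : Finset E) : (indicatorExp A).support = A := by
  ext a
  by_cases ha : a ∈ A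
  · simp [ha, indicatorExp_apply_of_mem]
  · simp [ha, indicatorExp_apply_of_notMem]

theorem support_indicatorExp_add {A : Finset E} {n : E →₀ ℕ} (hn : n.support ⊆ A) :
    (indicatorExp A + n).support = A := by
  ext a
  by_cases ha : a ∈ A
  · simp [ha, indicatorExp_apply_of_mem]
  · simp [ha, indicatorExp_apply_of_notMem, Finsupp.notMem_support_iff.1 fun h => ha (hn h)]

theorem degree_indicatorExp (A : Finset E) : (indicatorExp A).degree = A.card := by
  simp [indicatorExp]

variable (G) in
/-- Pairs of an element `y` of the independence poset and an exponent vector supported on the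
underlying face of `y`. -/
abbrev SRIndex : Type _ := Σ y : G.Ind, {n : E →₀ ℕ // n.support ⊆ y.shape}

/-- The degree of the basis element with a given index. -/
def SRIndex.degree (i : G.SRIndex) : ℕ := i.1.shape.card + i.2.1.degree

variable [Finite E] (K : Type*) [Field K]

/-- The basis elements `y ∏ y_a ^ n_a` of the Stanley–Reisner ring, where `y_a` is the atom below `y`
that corresponds to `a`. -/
def srMonomial [DecidableEq E] (y : G.Ind) (n : E →₀ ℕ) : StanleyReisnerRing G.Ind K :=
  srVar K y * ∏ a ∈ y.shape, srVar K (y.restrict {a}) ^ n a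

open Classical in
/-- The map to the polynomial ring on `E` that sends `z ≤ u` to the squarefree monomial supported on
the underlying face of `z`, and all other variables to `0`. -/
def evalBelow (u : G.Ind) : StanleyReisnerRing G.Ind K →ₐ[K] MvPolynomial E K :=
  Ideal.Quotient.liftₐ (stanleyReisnerIdeal G.Ind K)
    (MvPolynomial.aeval fun z : G.Ind =>
      if z ≤ u then MvPolynomial.monomial (indicatorExp z.shape) (1 : K) else 0) <| by
    suffices h : stanleyReisnerIdeal G.Ind K ≤ RingHom.ker (MvPolynomial.aeval fun z : G.Ind =>
        if z ≤ u then MvPolynomial.monomial (indicatorExp z.shape) (1 : K) else 0) from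
      fun p hp => h hp
    refine Ideal.span_le.2 ?_
    rintro _ (⟨y, z, h⟩ | ⟨y, z, m, h, hm⟩ | ⟨b, hb⟩)
    · rw [SetLike.mem_coe, RingHom.mem_ker, map_mul, MvPolynomial.aeval_X, MvPolynomial.aeval_X]
      by_cases hy : y ≤ u
      · by_cases hz : z ≤ u
        · exact absurd ⟨u, by rintro x (rfl | rfl) <;> assumption⟩ h
        · rw [if_neg hz, mul_zero]
      · rw [if_neg hy, zero_mul]
    · rw [SetLike.mem_coe, RingHom.mem_ker]
      simp only [map_sub, map_mul, map_sum, MvPolynomial.aeval_X, Ind.minimal_upperBounds_iff]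
      by_cases hyz : y ≤ u ∧ z ≤ u
      · obtain ⟨hy, hz⟩ := hyz
        obtain ⟨hmu, hms⟩ := (Ind.isGLB_iff hy hz m).1 hm
        have hs : (u.restrict (y.shape ∪ z.shape)).shape = y.shape ∪ z.shape :=
          Ind.shape_restrict_of_subset
            (Finset.union_subset (Ind.shape_mono hy) (Ind.shape_mono hz))
        rw [if_pos hy, if_pos hz, if_pos hmu,
          Finset.sum_eq_single (u.restrict (y.shape ∪ z.shape)), if_pos (u.restrict_le _), hs, hms,
          MvPolynomial.monomial_mul, MvPolynomial.monomial_mul, sub_eq_zero]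
        -- Inclusion–exclusion for exponents: the indicators of two sets add up to those of their
        -- union and intersection.
        · congr 1
          simp only [indicatorExp]
          rw [add_comm (∑ a ∈ y.shape ∩ z.shape, _), Finset.sum_union_inter]
        · intro w hw hne
          rw [Set.Finite.mem_toFinset] at hw
          refine if_neg fun hwu => hne ?_
          exact Ind.eq_of_shape_eq hwu (u.restrict_le _) (hw.2.2.trans hs.symm)
        · intro h
          refine absurd ?_ h
          rw [Set.Finite.mem_toFinset]
          exact ⟨Ind.le_of_shape_subset hy (u.restrict_le _) (Finset.subset_union_left.trans hs.ge),
            Ind.le_of_shape_subset hz (u.restrict_le _) (Finset.subset_union_right.trans hs.ge), hs⟩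
      -- If `y` or `z` is not below `u`, then neither is any common upper bound `w`, so both terms
      -- vanish.
      · rw [Finset.sum_eq_zero, mul_zero, sub_zero]
        · by_cases hy : y ≤ u
          · rw [if_neg fun hz => hyz ⟨hy, hz⟩, mul_zero]
          · rw [if_neg hy, zero_mul]
        · intro w hw
          rw [Set.Finite.mem_toFinset] at hw
          exact if_neg fun hwu => hyz ⟨hw.1.trans hwu, hw.2.1.trans hwu⟩
    · rw [SetLike.mem_coe, RingHom.mem_ker, map_sub, MvPolynomial.aeval_X, if_pos (hb u),
        Ind.shape_eq_empty_of_isBot hb, sub_eq_zero]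
      exact (map_one _).symm

variable {K}

theorem evalBelow_srVar_of_le {z u : G.Ind} (h : z ≤ u) :
    evalBelow K u (srVar K z) = MvPolynomial.monomial (indicatorExp z.shape) 1 := by
  classical
  refine (MvPolynomial.aeval_X _ _).trans (if_pos h)

theorem evalBelow_srVar_of_not_le {z u : G.Ind} (h : ¬ z ≤ u) :
    evalBelow K u (srVar K z) = 0 := by
  classical
  refine (MvPolynomial.aeval_X _ _).trans (if_neg h)

theorem evalBelow_srMonomial_of_le [DecidableEq E] {y u : G.Ind} (h : y ≤ u) {n : E →₀ ℕ}
    (hn : n.support ⊆ y.shape) :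
    evalBelow K u (srMonomial K y n) = MvPolynomial.monomial (indicatorExp y.shape + n) 1 := by
  have h1 : ∀ a ∈ y.shape, evalBelow K u (srVar K (y.restrict {a})) = MvPolynomial.X a := by
    intro a ha
    rw [evalBelow_srVar_of_le ((y.restrict_le _).trans h),
      Ind.shape_restrict_of_subset (Finset.singleton_subset_iff.2 ha), indicatorExp,
      Finset.sum_singleton]
    rfl
  rw [srMonomial, map_mul, map_prod, evalBelow_srVar_of_le h,
    Finset.prod_congr rfl fun a ha => by rw [map_pow, h1 a ha],
    ← Finset.prod_subset hn fun a _ ha => by rw [Finsupp.notMem_support_iff.1 ha, pow_zero],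
    show (1 : K) = 1 * 1 from (one_mul 1).symm, ← MvPolynomial.monomial_mul, one_mul]
  congr 1
  rw [MvPolynomial.monomial_eq, map_one, one_mul]
  rfl

/-- The functional dual to `(y, n)` applies `evalBelow y` and takes the coefficient at `indicatorExp
y.shape + n`. The support of this exponent is the face of `y`, so a basis element `(z, k)` with `z ≤
y` that contributes to it has `z = y`, and then `k = n`. -/
theorem linearIndependent_srMonomial [DecidableEq E] :
    LinearIndependent K fun i : G.SRIndex => srMonomial K i.1 i.2.1 := by
  refine LinearIndependent.of_pairwise_dual_eq_zero_one _
    (fun i => (MvPolynomial.lcoeff K (indicatorExp i.1.shape + i.2.1)).comp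
      (evalBelow K i.1).toLinearMap) ?_ ?_
  · rintro ⟨y, n, hn⟩ ⟨z, k, hk⟩ hne
    simp only [LinearMap.comp_apply, AlgHom.toLinearMap_apply, MvPolynomial.lcoeff_apply]
    by_cases hzy : z ≤ y
    · rw [evalBelow_srMonomial_of_le hzy hk, MvPolynomial.coeff_monomial, if_neg]
      intro heq
      have hs : z.shape = y.shape := by
        rw [← support_indicatorExp_add hk, heq, support_indicatorExp_add hn]
      obtain rfl := Ind.eq_of_le_of_shape_eq hzy hs
      obtain rfl := add_left_cancel heq
      exact hne rfl
    · rw [srMonomial, map_mul, evalBelow_srVar_of_not_le hzy, zero_mul, MvPolynomial.coeff_zero]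
  · rintro ⟨y, n, hn⟩
    simp only [LinearMap.comp_apply, AlgHom.toLinearMap_apply, MvPolynomial.lcoeff_apply]
    rw [evalBelow_srMonomial_of_le le_rfl hn, MvPolynomial.coeff_monomial, if_pos rfl]

variable (G K) in
/-- The span of the basis elements of degree `N`. -/
def srSpan [DecidableEq E] (N : ℕ) : Submodule K (StanleyReisnerRing G.Ind K) :=
  Submodule.span K ((fun i : G.SRIndex => srMonomial K i.1 i.2.1) '' {i | i.degree = N})

theorem srMonomial_mem_srSpan [DecidableEq E] {y : G.Ind} {n : E →₀ ℕ} (hn : n.support ⊆ y.shape)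
    {N : ℕ} (h : y.shape.card + n.degree = N) : srMonomial K y n ∈ srSpan G K N :=
  Submodule.subset_span ⟨⟨y, n, hn⟩, h, rfl⟩

/-- The straightening step: each minimal upper bound `w` of `z` and `y` yields one basis element, in
which the meet contributes an extra exponent `1` on the intersection of the faces. -/
theorem IsTorsionFree.srVar_mul_srMonomial_mem [DecidableEq E] (hG : G.IsTorsionFree)
    (z y : G.Ind) {n : E →₀ ℕ} (hn : n.support ⊆ y.shape) :
    srVar K z * srMonomial K y n ∈ srSpan G K (z.shape.card + (y.shape.card + n.degree)) := by
  by_cases hu : ∃ u, z ≤ u ∧ y ≤ u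
  · obtain ⟨u, hz, hy⟩ := hu
    have hzy : z.shape ∩ y.shape ⊆ u.shape := Finset.inter_subset_left.trans (Ind.shape_mono hz)
    have hs := Ind.shape_restrict_of_subset hzy
    rw [srMonomial, ← mul_assoc, srVar_mul hz hy (u.restrict_le _) hs, Finset.mul_sum,
      Finset.sum_mul]
    refine Submodule.sum_mem _ fun w hw => ?_
    rw [Set.Finite.mem_toFinset] at hw
    obtain ⟨hzw, hyw, hws⟩ := hw
    have hsub : z.shape ∩ y.shape ⊆ y.shape := Finset.inter_subset_right
    have hyw' := Ind.shape_mono hyw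
    -- The meet was built inside `u`, and `w` need not lie below `u`; both restrictions agree
    -- because they lie below `y`.
    have hm : u.restrict (z.shape ∩ y.shape) = w.restrict (z.shape ∩ y.shape) := by
      rw [Ind.restrict_eq_restrict hy hsub, Ind.restrict_eq_restrict hyw hsub]
    have key : srVar K (u.restrict (z.shape ∩ y.shape)) * srVar K w *
        ∏ a ∈ y.shape, srVar K (y.restrict {a}) ^ n a =
        srMonomial K w (indicatorExp (z.shape ∩ y.shape) + n) := by
      rw [hm, mul_comm (srVar K (w.restrict _)), hG.srVar_mul_restrict w (hsub.trans hyw'),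
        srMonomial, mul_assoc]
      congr 1
      simp only [Finsupp.add_apply, pow_add, Finset.prod_mul_distrib]
      congr 1
      · rw [← Finset.prod_subset (hsub.trans hyw') fun a _ ha => by
          rw [indicatorExp_apply_of_notMem ha, pow_zero]]
        exact Finset.prod_congr rfl fun a ha => by rw [indicatorExp_apply_of_mem ha, pow_one]
      · rw [← Finset.prod_subset hyw' fun a _ ha => by
          rw [Finsupp.notMem_support_iff.1 fun h => ha (hn h), pow_zero]]
        exact Finset.prod_congr rfl fun a ha => by
          rw [Ind.restrict_eq_restrict hyw (Finset.singleton_subset_iff.2 ha)]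
    rw [key]
    refine srMonomial_mem_srSpan ?_ ?_
    · refine Finsupp.support_add.trans (Finset.union_subset ?_ (hn.trans hyw'))
      rw [support_indicatorExp]
      exact hsub.trans hyw'
    · have := Finset.card_union_add_card_inter z.shape y.shape
      rw [map_add, degree_indicatorExp, hws]
      omega
  · rw [srMonomial, ← mul_assoc,
      srVar_mul_eq_zero fun u hz hy => hu ⟨u, hz, hy⟩, zero_mul]
    exact zero_mem _

theorem IsTorsionFree.srVar_mul_mem [DecidableEq E] (hG : G.IsTorsionFree) (z : G.Ind) {N : ℕ}
    {x : StanleyReisnerRing G.Ind K} (hx : x ∈ srSpan G K N) :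
    srVar K z * x ∈ srSpan G K (z.shape.card + N) := by
  induction hx using Submodule.span_induction with
  | mem x hx =>
    obtain ⟨⟨y, n, hn⟩, rfl, rfl⟩ := hx
    exact hG.srVar_mul_srMonomial_mem z y hn
  | zero => rw [mul_zero]; exact zero_mem _
  | add x y _ _ hx hy => rw [mul_add]; exact add_mem hx hy
  | smul c x _ hx => rw [mul_smul_comm]; exact Submodule.smul_mem _ _ hx

theorem IsTorsionFree.one_mem_srSpan [DecidableEq E] (hG : G.IsTorsionFree) :
    (1 : StanleyReisnerRing G.Ind K) ∈ srSpan G K 0 := by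
  have h : srMonomial K (⟨Δ.emptyFace, 0⟩ : G.Ind) 0 = 1 := by
    simp only [srMonomial, Finsupp.coe_zero, Pi.zero_apply, pow_zero, Finset.prod_const_one,
      mul_one]
    exact hG.srVar_eq_one rfl
  rw [← h]
  exact srMonomial_mem_srSpan (Finset.empty_subset _) rfl

theorem IsTorsionFree.srVar_pow_mul_mem [DecidableEq E] (hG : G.IsTorsionFree) (z : G.Ind) (k : ℕ)
    {N : ℕ} {x : StanleyReisnerRing G.Ind K} (hx : x ∈ srSpan G K N) :
    srVar K z ^ k * x ∈ srSpan G K (k * z.shape.card + N) := by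
  induction k with
  | zero => simpa using hx
  | succ k ih =>
    rw [pow_succ', mul_assoc, Nat.succ_mul, add_comm (k * _), add_assoc]
    exact hG.srVar_mul_mem z ih

theorem IsTorsionFree.mk_monomial_mem_srSpan [DecidableEq E] (hG : G.IsTorsionFree)
    (d : G.Ind →₀ ℕ) :
    Ideal.Quotient.mk (stanleyReisnerIdeal G.Ind K) (MvPolynomial.monomial d 1) ∈
      srSpan G K (Finsupp.weight posetRho d) := by
  induction d using Finsupp.induction with
  | zero =>
    rw [map_zero, MvPolynomial.monomial_zero', MvPolynomial.C_1, map_one]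
    exact hG.one_mem_srSpan
  | single_add z k d _ _ ih =>
    rw [show (1 : K) = 1 * 1 from (one_mul 1).symm, ← MvPolynomial.monomial_mul, map_mul, map_add,
      Finsupp.weight_single, posetRho_eq_card_shape, smul_eq_mul, ← MvPolynomial.X_pow_eq_monomial,
      map_pow]
    exact hG.srVar_pow_mul_mem z k ih

/-! ### The grading -/

theorem srVar_mem_stanleyReisnerGrading (z : G.Ind) :
    srVar K z ∈ stanleyReisnerGrading G.Ind K z.shape.card :=
  ⟨MvPolynomial.X z, posetRho_eq_card_shape z ▸ MvPolynomial.isWeightedHomogeneous_X K _ z, rfl⟩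

instance gradedMonoid_stanleyReisnerGrading :
    SetLike.GradedMonoid (stanleyReisnerGrading G.Ind K) where
  one_mem := ⟨1, MvPolynomial.isWeightedHomogeneous_one K _, map_one (Ideal.Quotient.mk _)⟩
  mul_mem := by
    rintro i j _ _ ⟨p, hp, rfl⟩ ⟨q, hq, rfl⟩
    exact ⟨p * q, MvPolynomial.IsWeightedHomogeneous.mul hp hq, map_mul (Ideal.Quotient.mk _) p q⟩

/-- Makes each graded piece the span of part of the basis, so directness, finiteness and dimension
can be read off from the index set. -/
theorem IsTorsionFree.stanleyReisnerGrading_eq [DecidableEq E] (hG : G.IsTorsionFree) (N : ℕ) :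
    stanleyReisnerGrading G.Ind K N = srSpan G K N := by
  refine le_antisymm ?_ (Submodule.span_le.2 ?_)
  · rintro _ ⟨p, hp, rfl⟩
    rw [SetLike.mem_coe, MvPolynomial.mem_weightedHomogeneousSubmodule] at hp
    induction hp using MvPolynomial.IsWeightedHomogeneous.induction_on with
    | zero => rw [map_zero]; exact zero_mem _
    | add p q _ _ hp hq => rw [map_add]; exact add_mem hp hq
    | monomial d r hr =>
      rw [← mul_one r, ← smul_eq_mul, ← MvPolynomial.smul_monomial, map_smul, ← hr]
      exact Submodule.smul_mem _ _ (hG.mk_monomial_mem_srSpan d)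
  · rintro _ ⟨⟨y, n, hn⟩, rfl, rfl⟩
    refine SetLike.mul_mem_graded (srVar_mem_stanleyReisnerGrading y) ?_
    have hdeg : n.degree = ∑ a ∈ y.shape, n a :=
      Finset.sum_subset hn fun a _ ha => Finsupp.notMem_support_iff.1 ha
    change _ ∈ stanleyReisnerGrading G.Ind K n.degree
    rw [hdeg]
    refine SetLike.prod_mem_graded _ _ _ fun a ha => ?_
    have h := SetLike.pow_mem_graded (n a) (srVar_mem_stanleyReisnerGrading (K := K) (y.restrict {a}))
    rwa [Ind.shape_restrict_of_subset (Finset.singleton_subset_iff.2 ha), Finset.card_singleton,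
      nsmul_one] at h

theorem iSup_stanleyReisnerGrading :
    ⨆ N, stanleyReisnerGrading G.Ind K N = ⊤ := by
  classical
  refine eq_top_iff.2 fun x _ => ?_
  obtain ⟨p, rfl⟩ := Ideal.Quotient.mk_surjective x
  induction p using MvPolynomial.induction_on' with
  | monomial d r =>
    refine Submodule.mem_iSup_of_mem (Finsupp.weight posetRho d) ?_
    exact ⟨_, MvPolynomial.isWeightedHomogeneous_monomial _ _ _ rfl, rfl⟩
  | add p q hp hq =>
    rw [map_add]
    exact add_mem (hp trivial) (hq trivial)

theorem IsTorsionFree.iSupIndep_stanleyReisnerGrading (hG : G.IsTorsionFree) :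
    iSupIndep (stanleyReisnerGrading G.Ind K) := by
  classical
  intro N
  simp only [hG.stanleyReisnerGrading_eq, srSpan]
  rw [← Submodule.span_iUnion₂, ← Set.image_iUnion₂]
  -- Disjoint subsets of an independent family have disjoint spans, and a basis index has only one
  -- degree.
  refine linearIndependent_srMonomial.disjoint_span_image (Set.disjoint_left.2 ?_)
  rintro i rfl hi
  simp only [Set.mem_iUnion] at hi
  obtain ⟨M, hM, h⟩ := hi
  exact hM h.symm

theorem IsTorsionFree.nonempty_gradedAlgebra (hG : G.IsTorsionFree) :
    Nonempty (GradedAlgebra (stanleyReisnerGrading G.Ind K)) :=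
  ⟨{ gradedMonoid_stanleyReisnerGrading,
      (DirectSum.isInternal_submodule_of_iSupIndep_of_iSup_eq_top
        hG.iSupIndep_stanleyReisnerGrading
        iSup_stanleyReisnerGrading).chooseDecomposition with }⟩

end Basis

end SurjFinAbStructure

/-! ### The h-vector as a sum over the poset -/

section HVector

variable {P : Type*} [PartialOrder P] [Fintype P]

theorem posetRho_le_posetRank (y : P) : posetRho y ≤ posetRank P :=
  le_csSup (Set.finite_range _).bddAbove ⟨y, rfl⟩

theorem sum_fVector_smul {M : Type*} [AddCommMonoid M] (F : ℕ → M) :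
    ∑ i ∈ Finset.range (posetRank P + 1), fVector P i • F i = ∑ y : P, F (posetRho y) := by
  classical
  rw [← Finset.sum_fiberwise_of_maps_to' (t := Finset.range (posetRank P + 1))
    fun y _ => Finset.mem_range_succ_iff.2 (posetRho_le_posetRank y)]
  refine Finset.sum_congr rfl fun i _ => ?_
  rw [Finset.sum_const, fVector, Nat.card_eq_fintype_card, Fintype.card_subtype]

theorem hPolynomial_eq_sum :
    hPolynomial P = ∑ y : P, ((Polynomial.X : ℤ[X]) - 1) ^ (posetRank P - posetRho y) := by
  rw [← sum_fVector_smul fun i => ((Polynomial.X : ℤ[X]) - 1) ^ (posetRank P - i), hPolynomial,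
    fPolynomial, Polynomial.sum_comp]
  refine Finset.sum_congr rfl fun i _ => ?_
  simp

/-- Reflection is `t ^ k * p(1/t)`; it is multiplicative as long as the degree bounds add up. -/
theorem Polynomial.reflect_X_sub_one_pow (k : ℕ) :
    Polynomial.reflect k (((Polynomial.X : ℤ[X]) - 1) ^ k) = (1 - Polynomial.X) ^ k := by
  induction k with
  | zero => simp
  | succ k ih =>
    have hd : ∀ j, (((Polynomial.X : ℤ[X]) - 1) ^ j).natDegree ≤ j := fun j => by
      simpa using Polynomial.natDegree_pow_le_of_le j (Polynomial.natDegree_X_sub_C_le (1 : ℤ))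
    rw [pow_succ, Polynomial.reflect_mul _ _ (hd k) (by simpa using hd 1), ih, pow_succ]
    congr 1
    rw [Polynomial.reflect_sub, Polynomial.reflect_one_X, ← Polynomial.C_1, Polynomial.reflect_C]
    simp

theorem Polynomial.reflect_X_sub_one_pow_of_le {k r : ℕ} (h : k ≤ r) :
    Polynomial.reflect r (((Polynomial.X : ℤ[X]) - 1) ^ k) =
      Polynomial.X ^ (r - k) * (1 - Polynomial.X) ^ k := by
  obtain ⟨j, rfl⟩ := Nat.exists_eq_add_of_le' h
  have hd : (((Polynomial.X : ℤ[X]) - 1) ^ k).natDegree ≤ k := by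
    simpa using Polynomial.natDegree_pow_le_of_le k (Polynomial.natDegree_X_sub_C_le (1 : ℤ))
  have := Polynomial.reflect_mul (1 : ℤ[X]) _ (F := j) (by simp) hd
  rw [one_mul, Polynomial.reflect_X_sub_one_pow, ← Polynomial.C_1, Polynomial.reflect_C] at this
  simpa using this

theorem hSeries_eq_sum :
    hSeries P = ∑ y : P, (PowerSeries.X : ℚ⟦X⟧) ^ posetRho y *
      (1 - PowerSeries.X) ^ (posetRank P - posetRho y) := by
  set r := posetRank P
  have hdeg : (hPolynomial P).natDegree ≤ r := by
    rw [hPolynomial_eq_sum]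
    refine Polynomial.natDegree_sum_le_of_forall_le _ _ fun y _ => ?_
    refine (Polynomial.natDegree_pow_le_of_le _
      (by simpa using Polynomial.natDegree_X_sub_C_le (1 : ℤ))).trans
      (show (r - posetRho y) * 1 ≤ r by omega)
  have h1 : Polynomial.reflect r (hPolynomial P) =
      ∑ y : P, Polynomial.X ^ posetRho y * (1 - Polynomial.X) ^ (r - posetRho y) := by
    have hs := map_sum (AddMonoidHom.mk' (Polynomial.reflect r) fun f g : ℤ[X] =>
      Polynomial.reflect_add f g r)
      (fun y : P => ((Polynomial.X : ℤ[X]) - 1) ^ (posetRank P - posetRho y)) Finset.univ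
    rw [← hPolynomial_eq_sum] at hs
    refine hs.trans (Finset.sum_congr rfl fun y _ => ?_)
    have hy : posetRho y ≤ r := posetRho_le_posetRank y
    refine (Polynomial.reflect_X_sub_one_pow_of_le (Nat.sub_le _ _)).trans ?_
    rw [Nat.sub_sub_self hy]
  -- Since `h_i` is the coefficient of `t ^ (r - i)`, the series is the reversal of `h_P` at `r`.
  have h2 : hSeries P =
      (((Polynomial.reflect r (hPolynomial P)).map (Int.castRingHom ℚ) : ℚ[X]) : ℚ⟦X⟧) := by
    ext j
    rw [hSeries, map_sum, Polynomial.coeff_coe, Polynomial.coeff_map, Polynomial.coeff_reflect]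
    simp only [PowerSeries.coeff_C_mul, PowerSeries.coeff_X_pow, mul_ite, mul_one, mul_zero,
      Finset.sum_ite_eq, Finset.mem_range]
    split_ifs with hj
    · rw [Polynomial.revAt_le (Nat.lt_succ_iff.1 hj)]
      rfl
    -- `revAt r` fixes indices above `r`, where the degree bound makes the coefficient zero.
    · rw [Polynomial.revAt_eq_self_of_lt (by omega),
        Polynomial.coeff_eq_zero_of_natDegree_lt (by omega), map_zero]
  rw [h2, h1, Polynomial.map_sum, ← Polynomial.coeToPowerSeries.ringHom_apply, map_sum]
  simp

/-- Here `PowerSeries.mk 1` is `1/(1-t)`; in the term of `y` it cancels `(1-t)^(r-ρ(y))` and leaves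
`ρ(y)` copies. -/
theorem hSeries_mul_inv :
    hSeries P * ((1 - PowerSeries.X : ℚ⟦X⟧) ^ posetRank P)⁻¹ =
      ∑ y : P, PowerSeries.X ^ posetRho y * PowerSeries.mk 1 ^ posetRho y := by
  have hmk := PowerSeries.mk_one_mul_one_sub_eq_one ℚ
  have hinv : ((1 - PowerSeries.X : ℚ⟦X⟧) ^ posetRank P)⁻¹ = PowerSeries.mk 1 ^ posetRank P := by
    rw [PowerSeries.inv_eq_iff_mul_eq_one (by simp), ← mul_pow, hmk, one_pow]
  rw [hSeries_eq_sum, hinv, Finset.sum_mul]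
  refine Finset.sum_congr rfl fun y _ => ?_
  obtain ⟨k, hk⟩ := Nat.exists_eq_add_of_le (posetRho_le_posetRank y)
  rw [hk, Nat.add_sub_cancel_left, pow_add, mul_assoc]
  congr 1
  rw [mul_left_comm, ← mul_pow, mul_comm (1 - _), hmk, one_pow, mul_one]

end HVector

/-! ### Counting basis elements and comparing with the torsion-free part -/

theorem PowerSeries.coeff_mk_one_pow_card {E : Type*} [DecidableEq E] (S : Finset E) (k : ℕ) :
    PowerSeries.coeff k ((PowerSeries.mk 1 : ℚ⟦X⟧) ^ S.card) = (S.finsuppAntidiag k).card := by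
  rw [← Finset.prod_const, PowerSeries.coeff_prod]
  simp

namespace SurjFinAbStructure

theorem sum_ind_posetRho {E : Type*} {Δ : FaceComplex E} {G : SurjFinAbStructure Δ}
    [Fintype G.Ind] [Fintype Δ.Face] {M : Type*} [AddCommMonoid M]
    (F : ℕ → M) :
    ∑ y : G.Ind, F (posetRho y) = ∑ S : Δ.Face, Nat.card (G.obj S) • F S.1.card := by
  have := fun S => Fintype.ofFinite (G.obj S)
  have e : ∑ y : G.Ind, F (posetRho y) = ∑ S : Δ.Face, ∑ _g : G.obj S, F S.1.card := by
    rw [Finset.sum_sigma']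
    exact Finset.sum_nbij' (fun y => y) (fun y => y)
      (fun y _ => Finset.mem_sigma.2 ⟨Finset.mem_univ _, Finset.mem_univ _⟩)
      (fun y _ => Finset.mem_univ (α := G.Ind) y) (by simp) (by simp)
      fun y _ => by rw [posetRho_eq_card_shape]; rfl
  rw [e]
  simp

theorem card_exponents {E : Type*} (S : Finset E) (N : ℕ) :
    Finite {n : E →₀ ℕ // n.support ⊆ S ∧ S.card + n.degree = N} ∧
    (Nat.card {n : E →₀ ℕ // n.support ⊆ S ∧ S.card + n.degree = N} : ℚ) =
      PowerSeries.coeff N (PowerSeries.X ^ S.card * PowerSeries.mk 1 ^ S.card) := by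
  classical
  have hdeg : ∀ n : E →₀ ℕ, n.support ⊆ S → n.degree = S.sum n := fun n hn =>
    Finset.sum_subset hn fun a _ ha => Finsupp.notMem_support_iff.1 ha
  rw [PowerSeries.coeff_X_pow_mul']
  split_ifs with h
  · have he : ∀ n : E →₀ ℕ, n ∈ S.finsuppAntidiag (N - S.card) ↔
        n.support ⊆ S ∧ S.card + n.degree = N := fun n => by
      rw [Finset.mem_finsuppAntidiag, and_comm]
      refine and_congr_right fun hn => ?_
      rw [hdeg n hn]
      omega
    refine ⟨.of_equiv _ (Equiv.subtypeEquivRight he), ?_⟩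
    rw [PowerSeries.coeff_mk_one_pow_card, ← Nat.card_congr (Equiv.subtypeEquivRight he),
      Nat.card_eq_fintype_card, Fintype.card_coe]
  -- For `N < S.card` the truncated `N - S.card` would be misleading; there are no exponent vectors.
  · have : IsEmpty {n : E →₀ ℕ // n.support ⊆ S ∧ S.card + n.degree = N} :=
      ⟨fun n => h (by have := n.2.2; omega)⟩
    exact ⟨inferInstance, by simp⟩

/-- First isomorphism theorem for the surjection `G(S) → G(∅)`. -/
theorem card_obj {E : Type*} {Δ : FaceComplex E} (G : SurjFinAbStructure Δ) (S : Δ.Face) :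
    Nat.card (G.obj S) = Nat.card (G.obj Δ.emptyFace) * Nat.card (G.torsionFreePart.obj S) := by
  rw [AddSubgroup.card_eq_card_quotient_mul_card_addSubgroup (G.toEmpty S).ker]
  congr 1
  exact Nat.card_congr (QuotientAddGroup.quotientKerEquivOfSurjective _
    (G.map_surjective (Δ.emptyFace_le S))).toEquiv

variable {E : Type*} [Finite E] {Δ : FaceComplex E} {G : SurjFinAbStructure Δ}

variable (G) in
/-- The basis elements of a given degree, sorted by their element of the independence poset. -/
def srIndexEquiv (N : ℕ) : {i : G.SRIndex // i.degree = N} ≃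
    Σ y : G.Ind, {n : E →₀ ℕ // n.support ⊆ y.shape ∧ y.shape.card + n.degree = N} where
  toFun i := ⟨i.1.1, i.1.2.1, i.1.2.2, i.2⟩
  invFun j := ⟨⟨j.1, j.2.1, j.2.2.1⟩, j.2.2.2⟩
  left_inv _ := rfl
  right_inv _ := rfl

instance finite_srIndex_degree (N : ℕ) : Finite {i : G.SRIndex // i.degree = N} := by
  have := fun y : G.Ind => (card_exponents y.shape N).1
  exact .of_equiv _ (srIndexEquiv G N).symm

theorem srSpan_eq_span_range [DecidableEq E] (K : Type*) [Field K] (N : ℕ) :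
    srSpan G K N = Submodule.span K
      (Set.range fun i : {i : G.SRIndex // i.degree = N} => srMonomial K i.1.1 i.1.2.1) := by
  rw [srSpan, Set.image_eq_range]
  rfl

variable {K : Type*} [Field K]

theorem IsTorsionFree.finite_stanleyReisnerGrading (hG : G.IsTorsionFree) (N : ℕ) :
    Module.Finite K (stanleyReisnerGrading G.Ind K N) := by
  classical
  rw [hG.stanleyReisnerGrading_eq, srSpan_eq_span_range]
  exact Module.Finite.span_of_finite K (Set.finite_range _)

theorem IsTorsionFree.finrank_stanleyReisnerGrading (hG : G.IsTorsionFree) (N : ℕ) :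
    Module.finrank K (stanleyReisnerGrading G.Ind K N) =
      Nat.card {i : G.SRIndex // i.degree = N} := by
  classical
  have := Fintype.ofFinite {i : G.SRIndex // i.degree = N}
  rw [hG.stanleyReisnerGrading_eq, srSpan_eq_span_range, finrank_span_eq_card,
    Nat.card_eq_fintype_card]
  exact linearIndependent_srMonomial.comp _ Subtype.val_injective

theorem IsTorsionFree.stanleyReisnerHilb_eq_sum [Fintype G.Ind] (hG : G.IsTorsionFree) :
    stanleyReisnerHilb G.Ind K =
      ∑ y : G.Ind, PowerSeries.X ^ posetRho y * PowerSeries.mk 1 ^ posetRho y := by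
  ext N
  have := fun y : G.Ind => (card_exponents y.shape N).1
  rw [stanleyReisnerHilb, PowerSeries.coeff_mk, hG.finrank_stanleyReisnerGrading,
    Nat.card_congr (srIndexEquiv G N), Nat.card_sigma, Nat.cast_sum, map_sum]
  exact Finset.sum_congr rfl fun y _ => by
    rw [(card_exponents y.shape N).2, posetRho_eq_card_shape]

theorem IsTorsionFree.stanleyReisnerHilb_eq (hG : G.IsTorsionFree) :
    stanleyReisnerHilb G.Ind K =
      hSeries G.Ind * ((1 - PowerSeries.X : ℚ⟦X⟧) ^ Δ.rank)⁻¹ := by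
  have := Fintype.ofFinite G.Ind
  rw [hG.stanleyReisnerHilb_eq_sum, ← hSeries_mul_inv, posetRank_eq_rank]

/-- Both posets have rank `Δ.rank`, so the two sums over faces differ only in the number of elements
over each face, by the constant factor of `card_obj`. -/
theorem hSeries_ind : hSeries G.Ind =
    PowerSeries.C (Nat.card (G.obj Δ.emptyFace) : ℚ) * hSeries G.torsionFreePart.Ind := by
  have := Fintype.ofFinite G.Ind
  have := Fintype.ofFinite G.torsionFreePart.Ind
  have := Fintype.ofFinite Δ.Face
  simp only [hSeries_eq_sum, posetRank_eq_rank]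
  rw [sum_ind_posetRho fun i => (PowerSeries.X : ℚ⟦X⟧) ^ i * (1 - PowerSeries.X) ^ (Δ.rank - i),
    sum_ind_posetRho fun i => (PowerSeries.X : ℚ⟦X⟧) ^ i * (1 - PowerSeries.X) ^ (Δ.rank - i),
    Finset.mul_sum]
  refine Finset.sum_congr rfl fun S _ => ?_
  rw [card_obj, mul_smul, nsmul_eq_mul, map_natCast]

end SurjFinAbStructure

theorem mainTheorem2 {K : Type*} [Field K] {E : Type*} [Finite E] (Δ : FaceComplex E)
    (G : SurjFinAbStructure Δ) :
    (G.IsTorsionFree →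
      IsSimplicialPoset G.Ind ∧
      Nonempty (GradedAlgebra (stanleyReisnerGrading G.Ind K)) ∧
      (∀ n, Module.Finite K (stanleyReisnerGrading G.Ind K n)) ∧
      stanleyReisnerHilb G.Ind K =
        hSeries G.Ind * ((1 - PowerSeries.X : PowerSeries ℚ) ^ Δ.rank)⁻¹) ∧
    (IsSimplicialPoset G.torsionFreePart.Ind ∧
      Nonempty (GradedAlgebra (stanleyReisnerGrading G.torsionFreePart.Ind K)) ∧
      (∀ n, Module.Finite K (stanleyReisnerGrading G.torsionFreePart.Ind K n)) ∧
      stanleyReisnerHilb G.torsionFreePart.Ind K =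
        PowerSeries.C (1 / (Nat.card (G.obj Δ.emptyFace) : ℚ)) *
          (hSeries G.Ind * ((1 - PowerSeries.X : PowerSeries ℚ) ^ Δ.rank)⁻¹)) := by
  have hT := G.isTorsionFree_torsionFreePart
  refine ⟨fun hG => ⟨hG.isSimplicialPoset, hG.nonempty_gradedAlgebra,
    hG.finite_stanleyReisnerGrading, hG.stanleyReisnerHilb_eq⟩, hT.isSimplicialPoset,
    hT.nonempty_gradedAlgebra, hT.finite_stanleyReisnerGrading, ?_⟩
  have hne : (Nat.card (G.obj Δ.emptyFace) : ℚ) ≠ 0 := Nat.cast_ne_zero.2 Nat.card_pos.ne'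
  rw [hT.stanleyReisnerHilb_eq, SurjFinAbStructure.hSeries_ind (G := G), mul_assoc, ← mul_assoc,
    ← map_mul, one_div_mul_cancel hne, map_one, one_mul]

end
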